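/- Fix integers $\delta\ge 0$ (the number of deletions) and $c>\delta$ with $c\ge 3\delta$. Consider any sequence of Guess \& Check (GC) codes for $\delta$ deletions with $c$ parity symbols, with message lengths $k\to\infty$ and chunking lengths $\ell=\ell(k)$ satisfying $\ell=\Omega(\log k)$. Then the average list size of the GC decoder satisfies $$\lim_{k\to+\infty}L_{av}=1 .$$ Here a GC code is as follows. *Encoding.* A message $\mathbf u\in\mathbb F_2^k$ is chunked into $K=\lceil k/\ell\rceil$ adjacent blocks of $\ell$ bits (the last one filled up with zeros), each block is mapped to a symbol of $GF(2^\ell)$ by a fixed $\mathbb F_2$-linear bijection $\mathbb F_2^\ell\to GF(2^\ell)$, the $c$ parity symbols of $(U_1,\dots,U_K)$ under a systematic linear $(K+c,K)$ MDS code over $GF(2^\ell)$ are computed and mapped back to $c\ell$ parity bits, and the codeword $\mathbf x$ consists of the $k$ bits of $\mathbf u$ followed by the parity bits, each repeated $\delta+1$ times; its length is $n=k+c(\delta+1)\ell$. The binary representation and the MDS code are arbitrary. *Decoding.* Let $\mathbf y$ arise from $\mathbf x$ by deleting the entries in a set $\mathbf d$ of $\delta$ positions. The decoder recovers the parity symbols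 from the repetition code. For each guess, i.e. each distribution of the $\delta$ deletions among the $K$ blocks, it places the block boundaries accordingly, treats the blocks affected by deletions as erasures, and fills them in by means of the first $\delta$ parity symbols. Of the strings so obtained it keeps those that are consistent with the remaining $c-\delta$ parity symbols and whose codewords have Levenshtein distance exactly $\delta$ from $\mathbf y$. The number of distinct strings that are left is the list size $L(\mathbf u,\mathbf d)$. Finally $L(\mathbf u)=\max_{\mathbf d}L(\mathbf u,\mathbf d)$, the maximum being over all sets of $\delta$ of the $n$ positions, and $L_{av}=\mathbb E\,L(\mathbf u)$ for $\mathbf u$ uniformly distributed on $\mathbb F_2^k$. -/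

import Mathlib

open Filter Topology Asymptotics

noncomputable section

namespace GC

/-- The systematic linear code with parity matrix `P`: all words `(U, U P)`. -/
def systematicCode {F : Type*} [Field F] {K c : ℕ} (P : Matrix (Fin K) (Fin c) F) :
    Submodule F (Fin K ⊕ Fin c → F) :=
  LinearMap.range
    ((LinearEquiv.sumArrowLequivProdArrow (Fin K) (Fin c) F F).symm.toLinearMap ∘ₗ
      (LinearMap.id.prod P.vecMulLinear))

open Classical in
/-- A linear code of length `n` and dimension `K` is MDS if its minimum Hamming distance attains
the Singleton bound `n - K + 1`, that is, if distinct codewords are at distance at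
least `n - K + 1`. -/
def IsMDS {F ι : Type*} [Field F] [Fintype ι] (C : Submodule F (ι → F)) : Prop :=
  ∀ x ∈ C, ∀ y ∈ C, x ≠ y → Fintype.card ι + 1 ≤ Module.finrank F C + hammingDist x y

/-- The data of a Guess & Check code with message length `k`, chunking length `ℓ` and `c` parity
symbols: an identification of the blocks of `ℓ` bits with the symbols of the field with `2 ^ ℓ`
elements (the coordinates in a basis over the field with two elements), and the parity matrix of
a systematic `(⌈k / ℓ⌉ + c, ⌈k / ℓ⌉)` MDS code. -/
structure Code (k ℓ c : ℕ) where
  toSymbol : (Fin ℓ → ZMod 2) ≃ₗ[ZMod 2] GaloisField 2 ℓ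
  parityMatrix : Matrix (Fin (k ⌈/⌉ ℓ)) (Fin c) (GaloisField 2 ℓ)
  isMDS : IsMDS (systematicCode parityMatrix)

/-- Delete from the string `x` the entries at the positions (counted from `0`) in `d`. -/
def deleteAt {α : Type*} (d : Finset ℕ) (x : List α) : List α :=
  (x.zipIdx.filter fun a => a.2 ∉ d).map Prod.fst

/-- The Levenshtein distance: the least number of insertions, deletions and substitutions of entries
that turn the first string into the second, by the usual recursion. -/
def levenshtein {α : Type*} [DecidableEq α] : List α → List α → ℕ
  | [], y => y.length
  | x, [] => x.length
  | a :: x, b :: y =>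
    min (min (levenshtein x (b :: y) + 1) (levenshtein (a :: x) y + 1))
      (levenshtein x y + if a = b then 0 else 1)
termination_by x y => x.length + y.length

/-- The number of bits of the `m`-th of the blocks into which `k` bits are chunked: it is `ℓ`,
except that the last block may be shorter. -/
def blockLength (k ℓ m : ℕ) : ℕ := min ℓ (k - m * ℓ)

/-- The guesses of the decoder: all distributions of `δ` deletions among `K` blocks. -/
def guesses (K δ : ℕ) : Finset (Fin K → ℕ) := Finset.piAntidiag Finset.univ δ

namespace Code

variable {k ℓ c : ℕ} (C : Code k ℓ c)

/-! ### Encoding -/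

/-- The `m`-th block of `ℓ` bits of the message `u`; the last block is filled up with zeros. -/
def block (ℓ : ℕ) {k : ℕ} (u : Fin k → ZMod 2) (m : ℕ) : Fin ℓ → ZMod 2 := fun j =>
  if h : m * ℓ + j < k then u ⟨m * ℓ + j, h⟩ else 0

/-- The symbols of the message `u`. -/
def symbols (u : Fin k → ZMod 2) : Fin (k ⌈/⌉ ℓ) → GaloisField 2 ℓ := fun m =>
  C.toSymbol (block ℓ u m)

/-- The parity symbols of the message `u`. -/
def parities (u : Fin k → ZMod 2) : Fin c → GaloisField 2 ℓ :=
  Matrix.vecMul (C.symbols u) C.parityMatrix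

/-- The codeword of the message `u` for `δ` deletions: the `k` message bits, followed by the
`c * ℓ` parity bits, each of them repeated `δ + 1` times. -/
def encode (δ : ℕ) (u : Fin k → ZMod 2) : List (ZMod 2) :=
  List.ofFn u ++
    (List.finRange c).flatMap fun r => (List.finRange ℓ).flatMap fun j =>
      List.replicate (δ + 1) (C.toSymbol.symm (C.parities u r) j)

/-! ### Decoding of a string `y` that results from a codeword by `δ` deletions -/

/-- The parity symbols as the decoder recovers them from the repetition code. The `i`-th parity bit
(`i = 0, 1, …`) fills the positions `k + i * (δ + 1), …, k + i * (δ + 1) + δ` of the codeword, and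
`δ` deletions move an entry by at most `δ` places: so the entry of `y` at the
position `k + i * (δ + 1)` is a copy of this bit. -/
def recoveredParities (δ : ℕ) (y : List (ZMod 2)) : Fin c → GaloisField 2 ℓ := fun r =>
  C.toSymbol fun j => y.getD (k + (r * ℓ + j) * (δ + 1)) 0

/-- The `m`-th block as it is read off from `y` under the guess `g`, for a block that the guess
takes to be free of deletions: the block starts at `m * ℓ` minus the number of deletions in the
earlier blocks. -/
def receivedBlock (k ℓ : ℕ) (y : List (ZMod 2)) (g : Fin (k ⌈/⌉ ℓ) → ℕ) (m : Fin (k ⌈/⌉ ℓ)) :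
    Fin ℓ → ZMod 2 := fun j =>
  if m * ℓ + j < k then y.getD (m * ℓ + j - ∑ i ∈ Finset.Iio m, g i) 0 else 0

/-- The string `v` is the result of the guess `g` on `y`: the blocks that the guess takes to be
affected by deletions are treated as erasures, `v` agrees with the received blocks elsewhere, and
the erasures are filled in such that the first `δ` parity symbols of `v` are the recovered ones.
(As the code is MDS and at most `δ` blocks are erased, there is at most one such `v`.) A block
cannot have lost more bits than it has. -/
def IsDecoded (δ : ℕ) (y : List (ZMod 2)) (g : Fin (k ⌈/⌉ ℓ) → ℕ) (v : Fin k → ZMod 2) : Prop :=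
  (∀ m, g m ≤ blockLength k ℓ m) ∧
  (∀ m, g m = 0 → block ℓ v m = receivedBlock k ℓ y g m) ∧
  ∀ r : Fin c, (r : ℕ) < δ → C.parities v r = C.recoveredParities δ y r

open Classical in
/-- The strings obtained in the guessing phase. -/
def initialList (δ : ℕ) (y : List (ZMod 2)) : Finset (Fin k → ZMod 2) :=
  Finset.univ.filter fun v => ∃ g ∈ guesses (k ⌈/⌉ ℓ) δ, C.IsDecoded δ y g v

open Classical in
/-- The list returned by the decoder: the codewords of the strings of the initial list that are
consistent with the remaining `c - δ` parity symbols and whose Levenshtein distance from `y`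
is exactly `δ`. -/
def finalList (δ : ℕ) (y : List (ZMod 2)) : Finset (List (ZMod 2)) :=
  ((C.initialList δ y).filter fun v =>
    (∀ r : Fin c, δ ≤ (r : ℕ) → C.parities v r = C.recoveredParities δ y r) ∧
    levenshtein (C.encode δ v) y = δ).image (C.encode δ)

/-! ### List sizes -/

/-- The list size for the message `u` and the deletion pattern `d`. -/
def listSizeAt (δ : ℕ) (u : Fin k → ZMod 2) (d : Finset ℕ) : ℕ :=
  (C.finalList δ (deleteAt d (C.encode δ u))).card

/-- The list size for the message `u`: the maximum over all patterns of `δ` deletions, that is, over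
all sets of `δ` positions in the codeword. -/
def listSize (δ : ℕ) (u : Fin k → ZMod 2) : ℕ :=
  ((Finset.range (C.encode δ u).length).powersetCard δ).sup (C.listSizeAt δ u)

/-- The average list size: the expectation of the list size for a uniform message. -/
def averageListSize (δ : ℕ) : ℝ :=
  (∑ u : Fin k → ZMod 2, (C.listSize δ u : ℝ)) / 2 ^ k

end Code

end GC

end

namespace GC

/-! ### Levenshtein distance, deletions and sublists. -/

section Lists

variable {α : Type*}

/-! For a suitable deletion pattern the codeword of `u` is in the list, so the point is that the
expected number of other candidates tends to zero. Another candidate `v` has the parity symbols of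
`u`, because the repetition code protects them, and a Levenshtein distance equal to the length
difference allows deletions only. Hence `u` and `v` become equal after deleting sets `d` and `e` of
δ message positions (`listSize_le`). A union bound runs over all pairs (d, e).

Fix (d, e) and let S be `disturbed k d e`; outside S the two messages agree. An aligned pair is
determined by u - v on S and by u outside `movedTo`, a set of |S| - δ positions, so there are at
most 2^(k+δ) such pairs. As u - v has zero parities, the MDS property recovers up to c whole blocks
inside S from the rest, which gains a factor 2^ℓ per block (`card_aligned_mul_le`).

If S fills c blocks, the gain 2^(cℓ) pays for all k^(2δ) choices of (d, e). Otherwise, u - v ≠ 0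
forces S to touch more than c blocks, and S has at most 2δ boundaries (`card_touched_le`), so at
least c + 1 - 2δ ≥ δ + 1 blocks are filled. Moreover S has fewer than (c + 2δ)ℓ positions, which
keeps `e` close to `d` and leaves only O(k^δ ℓ^δ) choices.

For c ≥ 2 the MDS property also gives k ≤ ℓ 2^ℓ (`Code.le_mul_two_pow`). Both contributions, divided
by 2^k, are then O(ℓ^(2δ) / 2^ℓ). -/

theorem length_le_levenshtein_add [DecidableEq α] (x y : List α) :
    x.length ≤ levenshtein x y + y.length := by
  induction x, y using levenshtein.induct with
  | case1 y => simp
  | case2 x _ => cases x <;> simp [levenshtein]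
  | case3 a x b y h1 h2 h3 =>
    rw [levenshtein]
    simp only [List.length_cons] at *
    split <;> omega

/-- Insertions and substitutions cost one without reducing the length, so a cost equal to the length
difference leaves only deletions and free matches. -/
theorem sublist_of_levenshtein [DecidableEq α] (x y : List α)
    (h : levenshtein x y + y.length = x.length) : y.Sublist x := by
  induction x, y using levenshtein.induct with
  | case1 y => simp [levenshtein] at h; simp [h]
  | case2 x _ => simp
  | case3 a x b y h1 h2 h3 =>
    have l2 := length_le_levenshtein_add (a :: x) y
    have l3 := length_le_levenshtein_add x y
    rw [levenshtein] at h
    simp only [List.length_cons] at *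
    split at h
    · subst a
      by_cases h4 : levenshtein x (b :: y) + 1 + (y.length + 1) = x.length + 1
      · exact (h1 (by omega)).cons _
      · exact (h3 (by omega)).cons_cons _
    · exact (h1 (by omega)).cons _

theorem levenshtein_cons_le [DecidableEq α] (a : α) (x y : List α) :
    levenshtein (a :: x) y ≤ levenshtein x y + 1 := by
  cases y with
  | nil => cases x <;> simp [levenshtein]
  | cons b y => rw [levenshtein]; omega

theorem levenshtein_self [DecidableEq α] (x : List α) : levenshtein x x = 0 := by
  induction x with
  | nil => simp [levenshtein]
  | cons a x ih => rw [levenshtein]; simp [ih]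

theorem levenshtein_append_self [DecidableEq α] (a y : List α) :
    levenshtein (a ++ y) y = a.length := by
  apply le_antisymm
  · induction a with
    | nil => simp [levenshtein_self]
    | cons b a ih => simpa using (levenshtein_cons_le b (a ++ y) y).trans (by omega)
  · have := length_le_levenshtein_add (a ++ y) y
    simp at this
    omega

theorem deleteAt_sublist (d : Finset ℕ) (x : List α) : (deleteAt d x).Sublist x := by
  have h := (List.filter_sublist (l := x.zipIdx) (p := fun a => decide (a.2 ∉ d))).map Prod.fst
  rwa [List.zipIdx_map_fst] at h

theorem length_deleteAt (d : Finset ℕ) (x : List α) (hd : d ⊆ Finset.range x.length) :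
    (deleteAt d x).length + d.card = x.length := by
  have key : ∀ (x : List α) (s : ℕ), ((x.zipIdx s).filter fun a => a.2 ∉ d).length +
      (d.filter fun i => s ≤ i ∧ i < s + x.length).card = x.length := by
    intro x
    induction x with
    | nil => intro s; simp
    | cons a x ih =>
      intro s
      have ih' := ih (s + 1)
      rw [List.zipIdx_cons]
      by_cases h : s ∈ d
      · have : (d.filter fun i => s ≤ i ∧ i < s + (a :: x).length) =
            insert s (d.filter fun i => s + 1 ≤ i ∧ i < s + 1 + x.length) := by
          ext i
          simp only [List.length_cons, Finset.mem_filter, Finset.mem_insert]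
          constructor
          · rintro ⟨h1, h2⟩
            by_cases h3 : i = s
            · exact Or.inl h3
            · exact Or.inr ⟨h1, by omega⟩
          · rintro (rfl | h1)
            · exact ⟨h, by omega⟩
            · exact ⟨h1.1, by omega⟩
        rw [this, Finset.card_insert_of_notMem (by simp)]
        simp [h] at ih' ⊢
        omega
      · have : (d.filter fun i => s ≤ i ∧ i < s + (a :: x).length) =
            (d.filter fun i => s + 1 ≤ i ∧ i < s + 1 + x.length) := by
          ext i
          simp only [List.length_cons, Finset.mem_filter]
          constructor
          · rintro ⟨h1, h2⟩
            have h3 : i ≠ s := by rintro rfl; exact h h1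
            exact ⟨h1, by omega⟩
          · rintro h1
            exact ⟨h1.1, by omega⟩
        rw [this]
        simp [h] at ih' ⊢
        omega
  have := key x 0
  rw [Finset.filter_true_of_mem] at this
  · simpa [deleteAt] using this
  · intro i hi
    simpa using hd hi

theorem deleteAt_range (n : ℕ) (x : List α) : deleteAt (Finset.range n) x = x.drop n := by
  have key : ∀ (x : List α) (s : ℕ),
      (((x.zipIdx s).filter fun a => a.2 ∉ Finset.range n).map Prod.fst) = x.drop (n - s) := by
    intro x
    induction x with
    | nil => intro s; simp
    | cons a x ih =>
      intro s
      rw [List.zipIdx_cons]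
      by_cases h : s < n
      · obtain ⟨t, rfl⟩ : ∃ t, n = s + 1 + t := ⟨n - (s + 1), by omega⟩
        have := ih (s + 1)
        rw [List.filter_cons_of_neg (by simp [h]), this]
        rw [show s + 1 + t - s = (s + 1 + t - (s + 1)) + 1 by omega, List.drop_succ_cons]
      · have := ih (s + 1)
        rw [List.filter_cons_of_pos (by simpa using h), List.map_cons, this]
        rw [show n - s = 0 by omega, show n - (s + 1) = 0 by omega]
        simp
  exact key x 0

/-- At most `n` entries of `a` are missing, so the part of `y` that comes from `a` has at least
`a.length - n` entries. -/
theorem take_sublist_of_sublist_append {y a b : List α} {n : ℕ} (h : y.Sublist (a ++ b))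
    (hn : y.length + n = (a ++ b).length) : (y.take (a.length - n)).Sublist a := by
  obtain ⟨y₁, y₂, rfl, h1, h2⟩ := List.sublist_append_iff.1 h
  have l1 := h1.length_le
  have l2 := h2.length_le
  simp only [List.length_append] at hn
  rw [List.take_append_of_le_length (by omega)]
  exact (List.take_sublist _ _).trans h1

theorem getD_flatMap {β : Type*} (f : β → List α) (b : ℕ) (hf : ∀ a, (f a).length = b) (z : α)
    (l : List β) (i s : ℕ) (hi : i < l.length) (hs : s < b) :
    (l.flatMap f).getD (i * b + s) z = (f l[i]).getD s z := by
  induction l generalizing i with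
  | nil => simp at hi
  | cons a l ih =>
    rw [List.flatMap_cons]
    cases i with
    | zero => rw [List.getD_append _ _ _ _ (by rw [hf]; omega)]; simp
    | succ i =>
      rw [List.getD_append_right _ _ _ _ (by rw [hf, Nat.succ_mul]; omega), hf]
      rw [show (i + 1) * b + s - b = i * b + s by rw [Nat.succ_mul]; omega]
      simpa using ih i (by simpa using hi)

/-- A sublist that lacks `n` entries takes its `i`-th entry from one of the
positions `i, …, i + n`. -/
theorem exists_getD_eq_of_sublist {x y : List α} {n : ℕ} (h : y.Sublist x)
    (hn : y.length + n = x.length) (z : α) (i : ℕ) (hi : i < y.length) :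
    ∃ s ≤ n, y.getD i z = x.getD (i + s) z := by
  induction h generalizing n i with
  | slnil => simp at hi
  | @cons y x a h ih =>
    have hl := h.length_le
    rw [List.length_cons] at hn
    obtain ⟨s, hs, e⟩ := ih (n := n - 1) (by omega) i hi
    exact ⟨s + 1, by omega, by rw [e, ← add_assoc]; simp⟩
  | @cons_cons y x a h ih =>
    cases i with
    | zero => exact ⟨0, by omega, by simp⟩
    | succ i =>
      simp only [List.length_cons] at hn hi
      obtain ⟨s, hs, e⟩ := ih (n := n) (by omega) i (by omega)
      refine ⟨s, hs, ?_⟩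
      rw [show i + 1 + s = i + s + 1 by omega]
      simpa using e

end Lists

/-! ### Sublists as enumerations of the kept positions. -/

theorem nth_notMem_of_strictMono {N k : ℕ} (φ : Fin N → ℕ) (hφ : StrictMono φ) (hk : ∀ i, φ i < k)
    (i : Fin N) : Nat.nth (· ∉ Finset.range k \ Finset.univ.image φ) i = φ i := by
  have hmem : φ i ∉ Finset.range k \ Finset.univ.image φ := by simp
  have hcount : Nat.count (· ∉ Finset.range k \ Finset.univ.image φ) (φ i) = i := by
    rw [Nat.count_eq_card_filter_range]
    have : (Finset.range (φ i)).filter (· ∉ Finset.range k \ Finset.univ.image φ) =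
        (Finset.Iio i).image φ := by
      ext p
      simp only [Finset.mem_filter, Finset.mem_range, Finset.mem_sdiff, Finset.mem_image,
        Finset.mem_univ, true_and, not_and, not_not, Finset.mem_Iio]
      constructor
      · rintro ⟨h1, h2⟩
        obtain ⟨j, rfl⟩ := h2 (h1.trans (hk i))
        exact ⟨j, hφ.lt_iff_lt.1 h1, rfl⟩
      · rintro ⟨j, h1, rfl⟩
        exact ⟨hφ h1, fun _ => ⟨j, rfl⟩⟩
    rw [this, Finset.card_image_of_injective _ hφ.injective, Fin.card_Iio]
  conv_lhs => rw [← hcount]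
  exact Nat.nth_count hmem

/-- The entries of the string `u`, continued by zeros. -/
def extend {k : ℕ} (u : Fin k → ZMod 2) (p : ℕ) : ZMod 2 := if h : p < k then u ⟨p, h⟩ else 0

theorem exists_deletion_of_sublist {k δ : ℕ} (u : Fin k → ZMod 2) (y : List (ZMod 2))
    (h : y.Sublist (List.ofFn u)) (hy : y.length + δ = k) :
    ∃ d ∈ (Finset.range k).powersetCard δ, ∀ j < k - δ,
      y.getD j 0 = extend u (Nat.nth (· ∉ d) j) := by
  obtain ⟨f, hf⟩ := List.sublist_iff_exists_fin_orderEmbedding_get_eq.1 h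
  have hmono : StrictMono fun i => (f i : ℕ) := fun i j hij => f.strictMono hij
  have hk : ∀ i, (f i : ℕ) < k := fun i => by simpa using (f i).2
  refine ⟨Finset.range k \ Finset.univ.image fun i => (f i : ℕ), ?_, ?_⟩
  · rw [Finset.mem_powersetCard]
    refine ⟨Finset.sdiff_subset, ?_⟩
    rw [Finset.card_sdiff_of_subset, Finset.card_image_of_injective _ hmono.injective]
    · simp; omega
    · intro p
      simp only [Finset.mem_image, Finset.mem_univ, true_and, Finset.mem_range]
      rintro ⟨i, rfl⟩
      exact hk i
  · intro j hj
    have hj' : j < y.length := by omega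
    have := nth_notMem_of_strictMono _ hmono hk ⟨j, hj'⟩
    simp only at this
    rw [this, List.getD_eq_getElem _ _ hj']
    have h2 := hf ⟨j, hj'⟩
    simp only [List.get_eq_getElem, List.getElem_ofFn] at h2
    rw [h2, extend, dif_pos (hk _)]

/-! ### Recovery of the parities; reduction to confusable messages. -/

namespace Code

variable {k ℓ c : ℕ} (C : Code k ℓ c)

theorem length_parityBits (δ : ℕ) (u : Fin k → ZMod 2) (r : Fin c) :
    ((List.finRange ℓ).flatMap fun j =>
      List.replicate (δ + 1) (C.toSymbol.symm (C.parities u r) j)).length = ℓ * (δ + 1) := by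
  rw [List.length_flatMap]
  simp

theorem length_encode (δ : ℕ) (u : Fin k → ZMod 2) :
    (C.encode δ u).length = k + c * (ℓ * (δ + 1)) := by
  rw [encode, List.length_append, List.length_ofFn, List.length_flatMap]
  simp only [length_parityBits]
  simp

theorem getD_encode (δ : ℕ) (u : Fin k → ZMod 2) (r : Fin c) (j : Fin ℓ) (s : ℕ) (hs : s ≤ δ) :
    (C.encode δ u).getD (k + (r * ℓ + j) * (δ + 1) + s) 0 =
      C.toSymbol.symm (C.parities u r) j := by
  rw [encode, List.getD_append_right _ _ _ _ (by simp; omega), List.length_ofFn]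
  have hlt : (j : ℕ) * (δ + 1) + s < ℓ * (δ + 1) := by
    have : ((j : ℕ) + 1) * (δ + 1) ≤ ℓ * (δ + 1) := Nat.mul_le_mul_right _ j.2
    rw [Nat.succ_mul] at this
    omega
  rw [show k + (r * ℓ + j) * (δ + 1) + s - k = r * (ℓ * (δ + 1)) + (j * (δ + 1) + s) by
    rw [add_mul, mul_assoc]; omega]
  rw [getD_flatMap _ _ (C.length_parityBits δ u) _ _ _ _ (by simp) hlt,
    getD_flatMap _ (δ + 1) (by simp) _ _ _ _ (by simp) (by omega)]
  simp [hs]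

/-- An entry of `y` stood at most δ places further right in the codeword, which is still among the δ
+ 1 copies of the same bit. -/
theorem recoveredParities_eq (δ : ℕ) (u : Fin k → ZMod 2) (y : List (ZMod 2))
    (h : y.Sublist (C.encode δ u)) (hy : y.length + δ = (C.encode δ u).length) :
    C.recoveredParities δ y = C.parities u := by
  funext r
  rw [recoveredParities, ← LinearEquiv.eq_symm_apply]
  funext j
  have hlt : k + (r * ℓ + j) * (δ + 1) < y.length := by
    rw [length_encode] at hy
    have h1 : ((j : ℕ) + 1) * (δ + 1) ≤ ℓ * (δ + 1) := Nat.mul_le_mul_right _ j.2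
    have h2 : ((r : ℕ) + 1) * (ℓ * (δ + 1)) ≤ c * (ℓ * (δ + 1)) := Nat.mul_le_mul_right _ r.2
    rw [Nat.succ_mul] at h1 h2
    rw [add_mul, mul_assoc]
    omega
  obtain ⟨s, hs, e⟩ := exists_getD_eq_of_sublist h hy 0 _ hlt
  rw [e, getD_encode _ _ _ _ _ _ hs]

/-- The messages `u` and `v` become equal when the sets `d` and `e` of positions are deleted. -/
def Aligned (δ : ℕ) (d e : Finset ℕ) (u v : Fin k → ZMod 2) : Prop :=
  ∀ j < k - δ, extend u (Nat.nth (· ∉ d) j) = extend v (Nat.nth (· ∉ e) j)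

theorem exists_aligned_of_mem_finalList {δ : ℕ} (hk : δ ≤ k) (u v : Fin k → ZMod 2)
    (y : List (ZMod 2)) (hyu : y.Sublist (C.encode δ u))
    (hy : y.length + δ = (C.encode δ u).length) (hyv : levenshtein (C.encode δ v) y = δ) :
    ∃ d ∈ (Finset.range k).powersetCard δ, ∃ e ∈ (Finset.range k).powersetCard δ,
      Aligned δ d e u v := by
  have hy' : y.length + δ = (C.encode δ v).length := by rw [hy, length_encode, length_encode]
  have hyv' : y.Sublist (C.encode δ v) := sublist_of_levenshtein _ _ (by omega)
  have su := take_sublist_of_sublist_append hyu hy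
  have sv := take_sublist_of_sublist_append hyv' hy'
  rw [List.length_ofFn] at su sv
  rw [length_encode] at hy
  have hl : (y.take (k - δ)).length + δ = k := by
    rw [List.length_take, min_eq_left (by omega)]; omega
  obtain ⟨d, hd, h1⟩ := exists_deletion_of_sublist u _ su hl
  obtain ⟨e, he, h2⟩ := exists_deletion_of_sublist v _ sv hl
  exact ⟨d, hd, e, he, fun j hj => by rw [← h1 j hj, ← h2 j hj]⟩

/-- The messages other than `u` that may be confused with `u`. -/
def Confusable (δ : ℕ) (u v : Fin k → ZMod 2) : Prop :=
  v ≠ u ∧ C.parities v = C.parities u ∧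
    ∃ d ∈ (Finset.range k).powersetCard δ, ∃ e ∈ (Finset.range k).powersetCard δ, Aligned δ d e u v

-- The guess is forgotten: only the parities (the first δ from the filling in, the others from the
-- check) and the distance condition are used. The bound does not depend on the pattern, which
-- disposes of the maximum.
open Classical in
theorem listSize_le {δ : ℕ} (hk : δ ≤ k) (u : Fin k → ZMod 2) :
    C.listSize δ u ≤ 1 + (Finset.univ.filter fun v => C.Confusable δ u v).card := by
  refine Finset.sup_le fun d hd => ?_
  rw [Finset.mem_powersetCard] at hd
  have hsub := deleteAt_sublist d (C.encode δ u)
  have hlen : (deleteAt d (C.encode δ u)).length + δ = _ := hd.2 ▸ length_deleteAt d _ hd.1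
  have hrec := C.recoveredParities_eq δ u _ hsub hlen
  refine Finset.card_image_le.trans ?_
  rw [add_comm, ← Finset.card_insert_of_notMem (a := u) (by simp [Confusable])]
  refine Finset.card_le_card fun v hv => ?_
  simp only [initialList, Finset.mem_filter, Finset.mem_univ, true_and] at hv
  obtain ⟨⟨g, -, -, -, h1⟩, h2, h3⟩ := hv
  rw [Finset.mem_insert]
  by_cases huv : v = u
  · exact Or.inl huv
  · refine Or.inr (by
      rw [Finset.mem_filter]
      refine ⟨Finset.mem_univ _, huv, ?_, C.exists_aligned_of_mem_finalList hk u v _ hsub hlen h3⟩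
      rw [← hrec]
      funext r
      by_cases hr : (r : ℕ) < δ
      · exact h1 r hr
      · exact h2 r (not_lt.1 hr))

theorem one_le_listSize {δ : ℕ} (hk : 0 < k) (hℓ : 0 < ℓ) (hδℓ : δ ≤ ℓ) (hδk : δ ≤ k)
    (u : Fin k → ZMod 2) : 1 ≤ C.listSize δ u := by
  have hK : 0 < k ⌈/⌉ ℓ := by
    rw [Nat.pos_iff_ne_zero]
    intro h
    have := (ceilDiv_le_iff_le_mul hℓ (b := k) (c := 0)).1 h.le
    omega
  have hd : Finset.range δ ∈ (Finset.range (C.encode δ u).length).powersetCard δ := by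
    rw [Finset.mem_powersetCard, length_encode]
    exact ⟨Finset.range_subset_range.2 (by omega), Finset.card_range δ⟩
  refine le_trans ?_ (Finset.le_sup (f := C.listSizeAt δ u) hd)
  rw [Nat.one_le_iff_ne_zero, listSizeAt, deleteAt_range, Finset.card_ne_zero]
  have hlen : ((C.encode δ u).drop δ).length + δ = (C.encode δ u).length := by
    rw [List.length_drop, length_encode]; omega
  have hrec := C.recoveredParities_eq δ u _ (List.drop_sublist δ _) hlen
  refine ⟨C.encode δ u, Finset.mem_image_of_mem _ ?_⟩
  simp only [initialList, Finset.mem_filter, Finset.mem_univ, true_and]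
  -- The first δ bits were deleted; the correct guess puts all deletions into block 0, which is long
  -- enough since δ ≤ ℓ and δ ≤ k.
  refine ⟨⟨fun m => if (m : ℕ) = 0 then δ else 0, ?_, ?_, ?_, ?_⟩, ?_, ?_⟩
  · simp only [guesses, Finset.mem_piAntidiag, Finset.mem_univ, implies_true, and_true]
    rw [Finset.sum_eq_single ⟨0, hK⟩]
    · simp
    · intro m _ hm
      rw [if_neg]
      intro h
      exact hm (Fin.ext h)
    · simp
  · intro m
    by_cases hm : (m : ℕ) = 0
    · simp [hm, blockLength, hδℓ, hδk]
    · simp [hm]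
  · intro m hm
    funext j
    rw [block, receivedBlock]
    by_cases hj : (m : ℕ) * ℓ + j < k
    · rw [dif_pos hj, if_pos hj]
      have hsum : ∑ i ∈ Finset.Iio m, (if (i : ℕ) = 0 then δ else 0) = δ := by
        by_cases hm0 : (m : ℕ) = 0
        · have : δ = 0 := by simpa [hm0] using hm
          simp [this]
        · rw [Finset.sum_eq_single ⟨0, hK⟩]
          · simp
          · intro i _ hi
            rw [if_neg]
            intro h
            exact hi (Fin.ext h)
          · intro h
            exact absurd (Finset.mem_Iio.2 (Fin.lt_def.2 (Nat.pos_of_ne_zero hm0))) h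
      have hle : δ ≤ m * ℓ + j := by
        by_cases hm0 : (m : ℕ) = 0
        · have : δ = 0 := by simpa [hm0] using hm
          omega
        · have : 1 * ℓ ≤ m * ℓ := Nat.mul_le_mul_right _ (Nat.pos_of_ne_zero hm0)
          omega
      rw [hsum, List.getD_eq_getElem?_getD, List.getElem?_drop, ← List.getD_eq_getElem?_getD,
        Nat.add_sub_cancel' hle, encode, List.getD_append _ _ _ _ (by simpa using hj),
        List.getD_eq_getElem _ _ (by simpa using hj)]
      simp
    · rw [dif_neg hj, if_neg hj]
  · intro r _
    rw [hrec]
  · intro r _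
    rw [hrec]
  · have := levenshtein_append_self ((C.encode δ u).take δ) ((C.encode δ u).drop δ)
    rw [List.take_append_drop] at this
    rw [this, List.length_take, length_encode]
    omega

end Code

/-! ### Counting functions of a deletion set and of its complement. -/

section Counting

theorem count_mem_le_card (d : Finset ℕ) (p : ℕ) : Nat.count (· ∈ d) p ≤ d.card := by
  rw [Nat.count_eq_card_filter_range]
  exact Finset.card_le_card fun x hx => (Finset.mem_filter.1 hx).2

theorem count_mem_eq_card {d : Finset ℕ} {k p : ℕ} (hd : d ⊆ Finset.range k) (hp : k ≤ p) :
    Nat.count (· ∈ d) p = d.card := by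
  rw [Nat.count_eq_card_filter_range]
  congr 1
  ext x
  simp only [Finset.mem_filter, Finset.mem_range, and_iff_right_iff_imp]
  intro hx
  exact (Finset.mem_range.1 (hd hx)).trans_le hp

theorem count_mem_eq_of_forall_notMem {d : Finset ℕ} {a b : ℕ} (hab : a ≤ b)
    (h : ∀ x, a ≤ x → x < b → x ∉ d) : Nat.count (· ∈ d) a = Nat.count (· ∈ d) b := by
  induction b, hab using Nat.le_induction with
  | base => rfl
  | succ b hab ih =>
    rw [ih fun x h1 h2 => h x h1 (by omega), Nat.count_succ, if_neg (h b hab (by omega)), add_zero]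

theorem count_notMem_add (d : Finset ℕ) (p : ℕ) :
    Nat.count (· ∉ d) p + Nat.count (· ∈ d) p = p := by
  induction p with
  | zero => simp
  | succ p ih =>
    rw [Nat.count_succ, Nat.count_succ]
    by_cases h : p ∈ d <;> simp [h] <;> omega

theorem infinite_notMem (d : Finset ℕ) : (Set.ofPred (· ∉ d)).Infinite :=
  d.finite_toSet.infinite_compl

theorem strictMono_nth_notMem (d : Finset ℕ) : StrictMono (Nat.nth (· ∉ d)) :=
  Nat.nth_strictMono (infinite_notMem d)

theorem nth_notMem_notMem (d : Finset ℕ) (j : ℕ) : Nat.nth (· ∉ d) j ∉ d :=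
  Nat.nth_mem_of_infinite (infinite_notMem d) j

theorem count_nth_notMem (d : Finset ℕ) (j : ℕ) :
    Nat.count (· ∉ d) (Nat.nth (· ∉ d) j) = j :=
  Nat.count_nth_of_infinite (infinite_notMem d) j

theorem nth_notMem_lt_iff {d : Finset ℕ} {k δ : ℕ} (hd : d ∈ (Finset.range k).powersetCard δ)
    (j : ℕ) : Nat.nth (· ∉ d) j < k ↔ j < k - δ := by
  rw [Finset.mem_powersetCard] at hd
  have h1 := count_notMem_add d k
  rw [count_mem_eq_card hd.1 le_rfl, hd.2] at h1
  rw [show k - δ = Nat.count (· ∉ d) k by omega]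
  exact (Nat.lt_nth_iff_count_lt (infinite_notMem d)).symm

end Counting

/-- The positions at which a message may change when the positions in `d` are deleted and entries
are inserted at the positions in `e`. -/
def disturbed (k : ℕ) (d e : Finset ℕ) : Finset ℕ :=
  (Finset.range k).filter fun p =>
    p ∈ d ∨ p ∈ e ∨ Nat.count (· ∈ d) p ≠ Nat.count (· ∈ e) p

/-! ### Size and shape of the disturbed set. -/

section Disturbed

variable {k δ : ℕ} {d e : Finset ℕ}

theorem mem_disturbed {p : ℕ} : p ∈ disturbed k d e ↔
    p < k ∧ (p ∈ d ∨ p ∈ e ∨ Nat.count (· ∈ d) p ≠ Nat.count (· ∈ e) p) := by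
  simp [disturbed]

theorem exists_nth_eq_of_notMem_disturbed {p : ℕ} (hp : p < k) (h : p ∉ disturbed k d e) :
    ∃ j, Nat.nth (· ∉ d) j = p ∧ Nat.nth (· ∉ e) j = p := by
  rw [mem_disturbed] at h
  push Not at h
  obtain ⟨h1, h2, h3⟩ := h hp
  refine ⟨Nat.count (· ∉ d) p, Nat.nth_count h1, ?_⟩
  have hd := count_notMem_add d p
  have he := count_notMem_add e p
  rw [show Nat.count (· ∉ d) p = Nat.count (· ∉ e) p by omega]
  exact Nat.nth_count h2

theorem nth_notMem_disturbed {j : ℕ} (h : Nat.nth (· ∉ d) j = Nat.nth (· ∉ e) j) :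
    Nat.nth (· ∉ d) j ∉ disturbed k d e := by
  rw [mem_disturbed]
  push Not
  intro _
  have h1 := count_notMem_add d (Nat.nth (· ∉ d) j)
  have h2 := count_notMem_add e (Nat.nth (· ∉ e) j)
  rw [count_nth_notMem] at h1 h2
  rw [← h] at h2
  exact ⟨nth_notMem_notMem d j, h ▸ nth_notMem_notMem e j, by omega⟩

/-- The later of the two positions at which an entry that is moved stands. -/
noncomputable def movedTo (k δ : ℕ) (d e : Finset ℕ) : Finset ℕ :=
  ((Finset.range (k - δ)).filter fun j => Nat.nth (· ∉ d) j ≠ Nat.nth (· ∉ e) j).image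
    fun j => max (Nat.nth (· ∉ d) j) (Nat.nth (· ∉ e) j)

theorem movedTo_subset (hd : d ∈ (Finset.range k).powersetCard δ)
    (he : e ∈ (Finset.range k).powersetCard δ) : movedTo k δ d e ⊆ Finset.range k := by
  intro p hp
  simp only [movedTo, Finset.mem_image, Finset.mem_filter, Finset.mem_range] at hp ⊢
  obtain ⟨j, ⟨hj, -⟩, rfl⟩ := hp
  exact max_lt ((nth_notMem_lt_iff hd j).2 hj) ((nth_notMem_lt_iff he j).2 hj)

/-- The maximum of two strictly increasing enumerations is injective, and the indices where they
agree correspond to the undisturbed positions; so (k - δ) - (k - |S|) entries move. -/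
theorem card_movedTo (hd : d ∈ (Finset.range k).powersetCard δ) :
    (movedTo k δ d e).card + δ = (disturbed k d e).card := by
  have hmax : StrictMono fun j => max (Nat.nth (· ∉ d) j) (Nat.nth (· ∉ e) j) := fun i j hij =>
    max_lt_max (strictMono_nth_notMem d hij) (strictMono_nth_notMem e hij)
  have h1 : (movedTo k δ d e).card = _ := Finset.card_image_of_injective _ hmax.injective
  have h2 := Finset.card_filter_add_card_filter_not (s := Finset.range (k - δ))
    (fun j => Nat.nth (· ∉ d) j = Nat.nth (· ∉ e) j)
  have h3 : (Finset.range k \ disturbed k d e) =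
      ((Finset.range (k - δ)).filter fun j => Nat.nth (· ∉ d) j = Nat.nth (· ∉ e) j).image
        (Nat.nth (· ∉ d)) := by
    ext p
    simp only [Finset.mem_sdiff, Finset.mem_range, Finset.mem_image, Finset.mem_filter]
    constructor
    · rintro ⟨hp, h⟩
      obtain ⟨j, hj, hj'⟩ := exists_nth_eq_of_notMem_disturbed hp h
      exact ⟨j, ⟨(nth_notMem_lt_iff hd j).1 (hj ▸ hp), hj.trans hj'.symm⟩, hj⟩
    · rintro ⟨j, ⟨hj, h⟩, rfl⟩
      exact ⟨(nth_notMem_lt_iff hd j).2 hj, nth_notMem_disturbed h⟩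
  have h4 := congrArg Finset.card h3
  have hsub : disturbed k d e ⊆ Finset.range k := Finset.filter_subset _ _
  rw [Finset.card_image_of_injective _ (strictMono_nth_notMem d).injective,
    Finset.card_sdiff_of_subset hsub, Finset.card_range] at h4
  have h5 := Finset.card_le_card hsub
  have h6 := Finset.card_le_card (Finset.mem_powersetCard.1 hd).1
  rw [Finset.card_range, (Finset.mem_powersetCard.1 hd).2] at h6
  rw [Finset.card_range] at h2 h5
  rw [h1]
  simp only [ne_eq] at *
  omega

/-- Every inserted position is close to a deleted one, unless many positions are disturbed. -/
theorem exists_near_of_card_disturbed_lt (hd : d ∈ (Finset.range k).powersetCard δ)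
    (he : e ∈ (Finset.range k).powersetCard δ) {B : ℕ} (hB : (disturbed k d e).card < B)
    {q : ℕ} (hq : q ∈ e) : ∃ p ∈ d, p ≤ q + B ∧ q ≤ p + B := by
  rw [Finset.mem_powersetCard] at hd he
  by_contra! hfar
  have hfar' : ∀ x, q - B ≤ x → x ≤ q + B → x ∉ d := fun x h1 h2 h3 => by
    have := hfar x h3 h2
    omega
  have hqk : q < k := Finset.mem_range.1 (he.1 hq)
  have hE : Nat.count (· ∈ e) (q + 1) = Nat.count (· ∈ e) q + 1 := by
    rw [Nat.count_succ, if_pos hq]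
  -- The count of `d` is constant near `q` while that of `e` jumps at `q`. So `e` is ahead on the
  -- `B` positions after `q`, or behind on the `B` positions up to `q`; these are all disturbed.
  rcases lt_or_ge (Nat.count (· ∈ d) (q + 1)) (Nat.count (· ∈ e) (q + 1)) with h | h
  · have hsub : Finset.Ioc q (q + B) ⊆ disturbed k d e := by
      intro x hx
      rw [Finset.mem_Ioc] at hx
      have h1 := count_mem_eq_of_forall_notMem (d := d) (a := q + 1) (b := x) (by omega)
        fun y h1 h2 => hfar' y (by omega) (by omega)
      have h2 : Nat.count (· ∈ e) (q + 1) ≤ Nat.count (· ∈ e) x := Nat.count_monotone _ (by omega)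
      rw [mem_disturbed]
      refine ⟨?_, Or.inr (Or.inr (by omega))⟩
      -- From `k` on the count of `d` has its full value δ, so `e` cannot be ahead there.
      by_contra hxk
      have h3 := count_mem_eq_card hd.1 (not_lt.1 hxk)
      have h4 := count_mem_le_card e x
      omega
    have := Finset.card_le_card hsub
    rw [Nat.card_Ioc] at this
    omega
  · have hDq : Nat.count (· ∈ d) q = Nat.count (· ∈ d) (q + 1) :=
      count_mem_eq_of_forall_notMem (by omega) fun y h1 h2 => hfar' y (by omega) (by omega)
    have key : ∀ x, q - B ≤ x → x ≤ q → Nat.count (· ∈ e) x < Nat.count (· ∈ d) x := by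
      intro x h1 h2
      have h3 := count_mem_eq_of_forall_notMem (d := d) (a := x) (b := q) h2
        fun y h1 h2 => hfar' y (by omega) (by omega)
      have h4 : Nat.count (· ∈ e) x ≤ Nat.count (· ∈ e) q := Nat.count_monotone _ h2
      omega
    have hBq : B ≤ q := by
      by_contra hBq
      have := key 0 (by omega) (by omega)
      simp at this
    have hsub : Finset.Ioc (q - B) q ⊆ disturbed k d e := by
      intro x hx
      rw [Finset.mem_Ioc] at hx
      rw [mem_disturbed]
      exact ⟨by omega, Or.inr (Or.inr (key x (by omega) (by omega)).ne')⟩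
    have := Finset.card_le_card hsub
    rw [Nat.card_Ioc] at this
    omega

/-- The blocks among the first `K` ones that contain a disturbed position. -/
def touched (K ℓ : ℕ) (S : Finset ℕ) : Finset ℕ :=
  (Finset.range K).filter fun m => ∃ j < ℓ, m * ℓ + j ∈ S

/-- The blocks among the first `K` ones that consist of disturbed positions. -/
def filled (K ℓ : ℕ) (S : Finset ℕ) : Finset ℕ :=
  (Finset.range K).filter fun m => ∀ j < ℓ, m * ℓ + j ∈ S

theorem exists_change {S : Finset ℕ} {a n : ℕ} (h1 : ∃ j < n, a + j ∈ S)
    (h2 : ∃ j < n, a + j ∉ S) :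
    ∃ j, j + 1 < n ∧ ¬ (a + j ∈ S ↔ a + j + 1 ∈ S) := by
  by_contra! h
  have key : ∀ j, j < n → (a + j ∈ S ↔ a ∈ S) := by
    intro j
    induction j with
    | zero => simp
    | succ j ih =>
      intro hj
      rw [← ih (by omega)]
      exact (h j hj).symm
  obtain ⟨i, hi, hi'⟩ := h1
  obtain ⟨j, hj, hj'⟩ := h2
  exact hj' ((key j hj).2 ((key i hi).1 hi'))

/-- A quantity that increases strictly along the positions `p` such that exactly one of `p` and
`p + 1` is disturbed. -/
def changeRank (k : ℕ) (d e : Finset ℕ) (p : ℕ) : ℕ :=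
  if p + 1 ∈ disturbed k d e then 2 * Nat.count (· ∈ d) (p + 1)
  else 2 * Nat.count (· ∈ d) (p + 1) - 1

theorem count_eq_of_notMem_disturbed (hd : d ∈ (Finset.range k).powersetCard δ)
    (he : e ∈ (Finset.range k).powersetCard δ) {p : ℕ} (hp : p ∉ disturbed k d e) :
    Nat.count (· ∈ d) p = Nat.count (· ∈ e) p ∧ p ∉ d ∧ p ∉ e := by
  rw [Finset.mem_powersetCard] at hd he
  by_cases hk : p < k
  · rw [mem_disturbed] at hp
    push Not at hp
    obtain ⟨h1, h2, h3⟩ := hp hk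
    exact ⟨h3, h1, h2⟩
  · rw [count_mem_eq_card hd.1 (not_lt.1 hk), count_mem_eq_card he.1 (not_lt.1 hk)]
    exact ⟨hd.2.trans he.2.symm, fun h => hk (Finset.mem_range.1 (hd.1 h)),
      fun h => hk (Finset.mem_range.1 (he.1 h))⟩

/-- The counts still agree at `p + 1`, so this position is disturbed by being in `d` or `e`; the sum
of the counts covers both cases. -/
theorem disturbed_start (hd : d ∈ (Finset.range k).powersetCard δ)
    (he : e ∈ (Finset.range k).powersetCard δ) {p : ℕ} (h1 : p ∉ disturbed k d e)
    (h2 : p + 1 ∈ disturbed k d e) :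
    Nat.count (· ∈ d) (p + 1) = Nat.count (· ∈ e) (p + 1) ∧
    2 * Nat.count (· ∈ d) (p + 1) + 1 ≤ Nat.count (· ∈ d) (p + 2) + Nat.count (· ∈ e) (p + 2) := by
  obtain ⟨h3, h4, h5⟩ := count_eq_of_notMem_disturbed hd he h1
  have h6 : Nat.count (· ∈ d) (p + 1) = Nat.count (· ∈ e) (p + 1) := by
    rw [Nat.count_succ, Nat.count_succ, if_neg h4, if_neg h5, h3]
  refine ⟨h6, ?_⟩
  rw [mem_disturbed] at h2
  rw [Nat.count_succ _ (p + 1), Nat.count_succ _ (p + 1)]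
  rcases h2.2 with h | h | h
  · rw [if_pos h]; omega
  · rw [if_pos h]; omega
  · exact absurd h6 h

/-- Here `q` is any earlier place of agreement, such as the entrance of a run or 0. As the counts
agree at both ends, growth of one of them is growth of both. -/
theorem disturbed_end (hd : d ∈ (Finset.range k).powersetCard δ)
    (he : e ∈ (Finset.range k).powersetCard δ) {p q : ℕ} (h1 : p ∈ disturbed k d e)
    (h2 : p + 1 ∉ disturbed k d e) (hq : q ≤ p)
    (hq' : Nat.count (· ∈ d) q = Nat.count (· ∈ e) q) :
    Nat.count (· ∈ d) (p + 1) = Nat.count (· ∈ e) (p + 1) ∧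
    Nat.count (· ∈ d) q < Nat.count (· ∈ d) (p + 1) := by
  obtain ⟨h3, -, -⟩ := count_eq_of_notMem_disturbed hd he h2
  refine ⟨h3, ?_⟩
  rw [mem_disturbed] at h1
  have m1 : Nat.count (· ∈ d) q ≤ Nat.count (· ∈ d) p := Nat.count_monotone _ hq
  have m2 : Nat.count (· ∈ e) q ≤ Nat.count (· ∈ e) p := Nat.count_monotone _ hq
  rw [Nat.count_succ, Nat.count_succ] at h3
  rw [Nat.count_succ]
  rcases h1.2 with h | h | h
  · rw [if_pos h]; omega
  · rw [if_pos h] at h3; split_ifs at h3 ⊢ <;> omega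
  · split_ifs at h3 ⊢ <;> omega

/-- At an entrance with common count a the rank is 2a. By the next exit the count has grown, so the
rank is at least 2(a + 1) - 1; a later entrance has at least the doubled count of that exit. -/
theorem changeRank_lt_changeRank (hd : d ∈ (Finset.range k).powersetCard δ)
    (he : e ∈ (Finset.range k).powersetCard δ) {p q : ℕ}
    (hp : ¬ (p ∈ disturbed k d e ↔ p + 1 ∈ disturbed k d e))
    (hq : ¬ (q ∈ disturbed k d e ↔ q + 1 ∈ disturbed k d e)) (hpq : p < q) :
    changeRank k d e p < changeRank k d e q := by
  have md : Nat.count (· ∈ d) (p + 1) ≤ Nat.count (· ∈ d) (q + 1) :=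
    Nat.count_monotone _ (by omega)
  have md' : Nat.count (· ∈ d) (p + 2) ≤ Nat.count (· ∈ d) (q + 1) :=
    Nat.count_monotone _ (by omega)
  have me' : Nat.count (· ∈ e) (p + 2) ≤ Nat.count (· ∈ e) (q + 1) :=
    Nat.count_monotone _ (by omega)
  by_cases hp' : p + 1 ∈ disturbed k d e
  · obtain ⟨a1, a2⟩ := disturbed_start hd he (by tauto) hp'
    by_cases hq' : q + 1 ∈ disturbed k d e
    · obtain ⟨b1, b2⟩ := disturbed_start hd he (by tauto) hq'
      rw [changeRank, changeRank, if_pos hp', if_pos hq']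
      omega
    · obtain ⟨b1, b2⟩ := disturbed_end hd he (q := p + 1) (by tauto) hq' (by omega) a1
      rw [changeRank, changeRank, if_pos hp', if_neg hq']
      omega
  · obtain ⟨a1, a2⟩ := disturbed_end hd he (q := 0) (by tauto) hp' (by omega) (by simp)
    by_cases hq' : q + 1 ∈ disturbed k d e
    · rw [changeRank, changeRank, if_neg hp', if_pos hq']
      omega
    · obtain ⟨b1, b2⟩ := disturbed_end hd he (q := p + 1) (by tauto) hq' (by omega) a1
      rw [changeRank, changeRank, if_neg hp', if_neg hq']
      omega

theorem changeRank_lt (hd : d ∈ (Finset.range k).powersetCard δ)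
    (he : e ∈ (Finset.range k).powersetCard δ) {p : ℕ}
    (hp : ¬ (p ∈ disturbed k d e ↔ p + 1 ∈ disturbed k d e)) :
    changeRank k d e p < 2 * δ := by
  have bd := fun p => (count_mem_le_card d p).trans_eq (Finset.mem_powersetCard.1 hd).2
  have be := fun p => (count_mem_le_card e p).trans_eq (Finset.mem_powersetCard.1 he).2
  by_cases hp' : p + 1 ∈ disturbed k d e
  · obtain ⟨a1, a2⟩ := disturbed_start hd he (by tauto) hp'
    rw [changeRank, if_pos hp']
    have := bd (p + 2)
    have := be (p + 2)
    omega
  · obtain ⟨a1, a2⟩ := disturbed_end hd he (q := 0) (by tauto) hp' (by omega) (by simp)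
    rw [changeRank, if_neg hp']
    have := bd (p + 1)
    omega

/-- A touched block that is not filled has a boundary of S between two of its own positions.
Distinct blocks give distinct boundaries, and `changeRank` embeds the boundaries into 2δ values. -/
theorem card_touched_le (hd : d ∈ (Finset.range k).powersetCard δ)
    (he : e ∈ (Finset.range k).powersetCard δ) (K ℓ : ℕ) :
    (touched K ℓ (disturbed k d e)).card ≤ (filled K ℓ (disturbed k d e)).card + 2 * δ := by
  set S := disturbed k d e with hS
  have hex : ∀ m ∈ touched K ℓ S \ filled K ℓ S,
      ∃ j, j + 1 < ℓ ∧ ¬ (m * ℓ + j ∈ S ↔ m * ℓ + j + 1 ∈ S) := by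
    intro m hm
    simp only [touched, filled, Finset.mem_sdiff, Finset.mem_filter] at hm
    refine exists_change hm.1.2 ?_
    by_contra! h
    exact hm.2 ⟨hm.1.1, h⟩
  choose! j hj hj' using hex
  have hcard : (touched K ℓ S \ filled K ℓ S).card ≤ (Finset.range (2 * δ)).card := by
    refine Finset.card_le_card_of_injOn (fun m => changeRank k d e (m * ℓ + j m)) ?_ ?_
    · intro m hm
      rw [Finset.mem_coe] at hm
      simpa using changeRank_lt hd he (hj' m hm)
    · have key : ∀ m ∈ touched K ℓ S \ filled K ℓ S, ∀ m' ∈ touched K ℓ S \ filled K ℓ S, m < m' →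
          changeRank k d e (m * ℓ + j m) < changeRank k d e (m' * ℓ + j m') := by
        intro m hm m' hm' hlt
        refine changeRank_lt_changeRank hd he (hj' m hm) (hj' m' hm') ?_
        have h1 := hj m hm
        have h2 : (m + 1) * ℓ ≤ m' * ℓ := Nat.mul_le_mul_right _ hlt
        rw [Nat.succ_mul] at h2
        omega
      intro m hm m' hm' h
      rw [Finset.mem_coe] at hm hm'
      simp only at h
      rcases lt_trichotomy m m' with hlt | heq | hlt
      · exact absurd h (key m hm m' hm' hlt).ne
      · exact heq
      · exact absurd h (key m' hm' m hm hlt).ne'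
  rw [Finset.card_range] at hcard
  have := Finset.le_card_sdiff (filled K ℓ S) (touched K ℓ S)
  omega

theorem card_le_card_touched_mul {K ℓ : ℕ} (hℓ : 0 < ℓ) (S : Finset ℕ)
    (hS : S ⊆ Finset.range (K * ℓ)) : S.card ≤ (touched K ℓ S).card * ℓ := by
  have hsub : S ⊆ (touched K ℓ S).biUnion fun m => Finset.Ico (m * ℓ) (m * ℓ + ℓ) := by
    intro p hp
    have h1 := Nat.div_add_mod' p ℓ
    have h2 := Nat.mod_lt p hℓ
    simp only [Finset.mem_biUnion, touched, Finset.mem_filter, Finset.mem_range, Finset.mem_Ico]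
    refine ⟨p / ℓ, ⟨?_, p % ℓ, h2, by rwa [h1]⟩, by omega, by omega⟩
    exact Nat.div_lt_of_lt_mul (by rw [mul_comm]; exact Finset.mem_range.1 (hS hp))
  exact (Finset.card_le_card hsub).trans (Finset.card_biUnion_le_card_mul _ _ _ (by simp))

/-- The positions in the blocks of `A`. -/
def blockPositions (ℓ : ℕ) (A : Finset ℕ) : Finset ℕ :=
  (A ×ˢ Finset.range ℓ).image fun a => a.1 * ℓ + a.2

theorem mul_add_mem_blockPositions {ℓ : ℕ} {A : Finset ℕ} {m j : ℕ} (hj : j < ℓ) :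
    m * ℓ + j ∈ blockPositions ℓ A ↔ m ∈ A := by
  simp only [blockPositions, Finset.mem_image, Finset.mem_product, Finset.mem_range, Prod.exists]
  constructor
  · rintro ⟨m', j', ⟨h1, h2⟩, h3⟩
    have h4 : (m' * ℓ + j') / ℓ = (m * ℓ + j) / ℓ := by rw [h3]
    rw [mul_comm m', mul_comm m, Nat.mul_add_div (by omega), Nat.mul_add_div (by omega),
      Nat.div_eq_of_lt h2, Nat.div_eq_of_lt hj] at h4
    have h5 : m' = m := by simpa using h4
    exact h5 ▸ h1
  · intro h
    exact ⟨m, j, ⟨h, hj⟩, rfl⟩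

theorem card_blockPositions (ℓ : ℕ) (A : Finset ℕ) :
    (blockPositions ℓ A).card = A.card * ℓ := by
  rw [blockPositions, Finset.card_image_of_injOn, Finset.card_product, Finset.card_range]
  rintro ⟨m, j⟩ h ⟨m', j'⟩ h' heq
  simp only [Finset.coe_product, Set.mem_prod, Finset.mem_coe, Finset.mem_range] at h h' heq
  have h4 : (m * ℓ + j) / ℓ = (m' * ℓ + j') / ℓ := by rw [heq]
  rw [mul_comm m', mul_comm m, Nat.mul_add_div (by omega), Nat.mul_add_div (by omega),
      Nat.div_eq_of_lt h.2, Nat.div_eq_of_lt h'.2] at h4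
  have h5 : m = m' := by simpa using h4
  subst h5
  simpa using heq

theorem blockPositions_subset {K ℓ : ℕ} {A S : Finset ℕ} (hA : A ⊆ filled K ℓ S) :
    blockPositions ℓ A ⊆ S := by
  intro p hp
  simp only [blockPositions, Finset.mem_image, Finset.mem_product, Finset.mem_range,
    Prod.exists] at hp
  obtain ⟨m, j, ⟨h1, h2⟩, rfl⟩ := hp
  exact (Finset.mem_filter.1 (hA h1)).2 j h2

end Disturbed

/-! ### Weights in MDS codes and the bound on their length. -/

section MDS

variable {F : Type*} [Field F] {K c : ℕ} {P : Matrix (Fin K) (Fin c) F}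

theorem finrank_systematicCode (P : Matrix (Fin K) (Fin c) F) :
    Module.finrank F (systematicCode P) = K := by
  rw [systematicCode, LinearMap.finrank_range_of_inj]
  · simp
  · rw [LinearMap.coe_comp]
    refine (LinearEquiv.injective _).comp fun x y h => ?_
    exact congrArg Prod.fst h

theorem sumElim_mem_systematicCode (P : Matrix (Fin K) (Fin c) F) (U : Fin K → F) :
    Sum.elim U (Matrix.vecMul U P) ∈ systematicCode P := by
  refine ⟨U, ?_⟩
  funext i
  rcases i with i | i <;> simp [LinearEquiv.sumArrowLequivProdArrow]

open Classical in
theorem IsMDS.lt_card_add_card (h : IsMDS (systematicCode P)) (U : Fin K → F) (hU : U ≠ 0) :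
    c < (Finset.univ.filter fun i => U i ≠ 0).card +
      (Finset.univ.filter fun r => Matrix.vecMul U P r ≠ 0).card := by
  have h1 := h _ (sumElim_mem_systematicCode P U) 0 (Submodule.zero_mem _) (by
    intro h0
    refine hU (funext fun i => ?_)
    exact congrFun h0 (Sum.inl i))
  rw [finrank_systematicCode, hammingDist, Fintype.card_sum, Fintype.card_fin, Fintype.card_fin,
    Finset.card_filter, Fintype.sum_sum_type, ← Finset.card_filter, ← Finset.card_filter] at h1
  rw [add_assoc] at h1
  refine (Nat.lt_of_succ_le (Nat.le_of_add_le_add_left h1)).trans_eq ?_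
  congr 2

open Classical in
theorem IsMDS.lt_card_of_vecMul_eq_zero (h : IsMDS (systematicCode P)) (U : Fin K → F)
    (hU : U ≠ 0) (h0 : Matrix.vecMul U P = 0) :
    c < (Finset.univ.filter fun i => U i ≠ 0).card := by
  simpa [h0] using h.lt_card_add_card U hU

/-- If there are more rows than field elements, two rows have the same ratio of entries in two fixed
columns. A combination of them cancels both columns and has weight at most 2 + (c - 2), too little
for an MDS code. -/
theorem IsMDS.le_card [Fintype F] (h : IsMDS (systematicCode P)) (hc : 2 ≤ c) :
    K ≤ Fintype.card F := by
  classical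
  by_contra! hlt
  set r₀ : Fin c := ⟨0, by omega⟩
  set r₁ : Fin c := ⟨1, by omega⟩
  have hr : r₀ ≠ r₁ := by simp [r₀, r₁]
  -- With a zero entry, a unit vector would give weight at most 1 + (c - 1).
  have hP : ∀ i r, P i r ≠ 0 := by
    intro i r h0
    have h1 := h.lt_card_add_card (Pi.single i 1) (by simp)
    have h2 : (Finset.univ.filter fun j => (Pi.single i 1 : Fin K → F) j ≠ 0) ⊆ {i} := by
      intro j hj
      by_contra hij
      simp_all
    have h3 : (Finset.univ.filter fun r => Matrix.vecMul (Pi.single i 1) P r ≠ 0) ⊆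
        Finset.univ.erase r := by
      intro s hs
      rw [Finset.mem_erase]
      refine ⟨?_, Finset.mem_univ _⟩
      rintro rfl
      simp [h0] at hs
    have h4 := Finset.card_le_card h2
    have h5 := Finset.card_le_card h3
    rw [Finset.card_erase_of_mem (Finset.mem_univ _)] at h5
    simp only [Finset.card_singleton, Finset.card_univ, Fintype.card_fin] at h4 h5
    omega
  obtain ⟨i, j, hij, heq⟩ := Fintype.exists_ne_map_eq_of_card_lt
    (fun i : Fin K => P i r₀ / P i r₁) (by simpa using hlt)
  rw [div_eq_div_iff (hP _ _) (hP _ _)] at heq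
  set U : Fin K → F := P j r₀ • Pi.single i 1 - P i r₀ • Pi.single j 1 with hUdef
  have hU : U ≠ 0 := by
    intro h0
    have := congrFun h0 i
    simp [hUdef, hij, hP] at this
  have h1 := h.lt_card_add_card U hU
  have h2 : (Finset.univ.filter fun l => U l ≠ 0) ⊆ {i, j} := by
    intro l hl
    by_contra hl'
    simp only [Finset.mem_insert, Finset.mem_singleton, not_or] at hl'
    simp [hUdef, hl'.1, hl'.2] at hl
  have hmul : ∀ r, Matrix.vecMul U P r = P j r₀ * P i r - P i r₀ * P j r := by
    intro r
    simp [hUdef, Matrix.sub_vecMul, Matrix.smul_vecMul]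
  have h3 : (Finset.univ.filter fun r => Matrix.vecMul U P r ≠ 0) ⊆
      (Finset.univ.erase r₀).erase r₁ := by
    intro s hs
    rw [Finset.mem_filter, hmul] at hs
    rw [Finset.mem_erase, Finset.mem_erase]
    refine ⟨?_, ?_, Finset.mem_univ _⟩
    · rintro rfl
      exact hs.2 (by rw [heq]; ring)
    · rintro rfl
      exact hs.2 (by ring)
  have h4 := Finset.card_le_card h2
  have h5 := Finset.card_le_card h3
  rw [Finset.card_erase_of_mem (by simp [hr.symm]), Finset.card_erase_of_mem (Finset.mem_univ _),
    Finset.card_univ, Fintype.card_fin] at h5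
  have h6 := Finset.card_le_two (a := i) (b := j)
  omega

end MDS

theorem le_ceilDiv_mul {k ℓ : ℕ} (hℓ : 0 < ℓ) : k ≤ (k ⌈/⌉ ℓ) * ℓ := by
  rw [mul_comm]
  exact (ceilDiv_le_iff_le_mul hℓ).1 le_rfl

theorem extend_sub {k : ℕ} (u v : Fin k → ZMod 2) (p : ℕ) :
    extend (u - v) p = extend u p - extend v p := by
  unfold extend
  split <;> simp

theorem extend_coe {k : ℕ} (u : Fin k → ZMod 2) (p : Fin k) : extend u p = u p := by
  simp [extend]

theorem eq_of_extend_eq {k : ℕ} {u v : Fin k → ZMod 2} (h : ∀ p < k, extend u p = extend v p) :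
    u = v :=
  funext fun p => by rw [← extend_coe u, ← extend_coe v, h p p.2]

/-! ### Messages with equal parities. -/

namespace Code

variable {k ℓ c : ℕ} (C : Code k ℓ c)

theorem symbols_sub (u v : Fin k → ZMod 2) : C.symbols (u - v) = C.symbols u - C.symbols v := by
  funext m
  have : block ℓ (u - v) m = block ℓ u m - block ℓ v m := by
    funext j
    exact extend_sub u v _
  rw [symbols, this, map_sub]
  rfl

theorem parities_sub (u v : Fin k → ZMod 2) :
    C.parities (u - v) = C.parities u - C.parities v := by
  rw [parities, symbols_sub, Matrix.sub_vecMul]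
  rfl

/-- With zero parity part, the whole weight, more than c, lies in the message symbols, and a nonzero
symbol needs a position of `S` in its block. -/
theorem lt_card_touched (hℓ : 0 < ℓ) {w : Fin k → ZMod 2} (hw : w ≠ 0) (hpar : C.parities w = 0)
    {S : Finset ℕ} (hS : ∀ p, p ∉ S → extend w p = 0) : c < (touched (k ⌈/⌉ ℓ) ℓ S).card := by
  classical
  have hU : C.symbols w ≠ 0 := by
    intro h0
    refine hw (eq_of_extend_eq fun p hp => ?_)
    have hlt : p / ℓ < k ⌈/⌉ ℓ :=
      Nat.div_lt_of_lt_mul (by rw [mul_comm]; exact hp.trans_le (le_ceilDiv_mul hℓ))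
    have h1 := congrFun h0 ⟨p / ℓ, hlt⟩
    rw [symbols, Pi.zero_apply, LinearEquiv.map_eq_zero_iff] at h1
    have h2 : extend w (p / ℓ * ℓ + p % ℓ) = 0 := congrFun h1 ⟨p % ℓ, Nat.mod_lt _ hℓ⟩
    rw [Nat.div_add_mod'] at h2
    rw [h2]
    simp [extend]
  refine (C.isMDS.lt_card_of_vecMul_eq_zero _ hU hpar).trans_le ?_
  refine Finset.card_le_card_of_injOn (fun m => (m : ℕ)) ?_ Fin.val_injective.injOn
  intro m hm
  simp only [Finset.coe_filter, Finset.mem_univ, true_and, Set.mem_ofPred_eq] at hm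
  simp only [touched, Finset.coe_filter, Finset.mem_range, Set.mem_ofPred_eq, m.2, true_and]
  by_contra! h
  refine hm ?_
  rw [symbols, LinearEquiv.map_eq_zero_iff]
  funext j
  exact hS _ (h j j.2)

theorem eq_of_parities_eq (hℓ : 0 < ℓ) {w w' : Fin k → ZMod 2} {A : Finset ℕ} (hA : A.card ≤ c)
    (hpar : C.parities w = C.parities w')
    (h : ∀ p < k, p ∉ blockPositions ℓ A → extend w p = extend w' p) : w = w' := by
  by_contra hne
  have h1 := C.lt_card_touched hℓ (sub_ne_zero.2 hne) (by rw [parities_sub, hpar, sub_self])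
    (S := blockPositions ℓ A) (fun p hp => by
      by_cases hk : p < k
      · rw [extend_sub, h p hk hp, sub_self]
      · rw [extend, dif_neg hk])
  have h2 : touched (k ⌈/⌉ ℓ) ℓ (blockPositions ℓ A) ⊆ A := by
    intro m hm
    obtain ⟨-, j, hj, hj'⟩ := Finset.mem_filter.1 hm
    exact (mul_add_mem_blockPositions hj).1 hj'
  have := Finset.card_le_card h2
  omega

end Code

theorem Code.le_mul_two_pow {k ℓ c : ℕ} (C : Code k ℓ c) (hℓ : 0 < ℓ) (hc : 2 ≤ c) : k ≤ ℓ * 2 ^ ℓ := by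
  have : Fintype (GaloisField 2 ℓ) := Fintype.ofFinite _
  have h1 := C.isMDS.le_card hc
  rw [← Nat.card_eq_fintype_card, GaloisField.card 2 ℓ hℓ.ne'] at h1
  rw [mul_comm]
  exact (le_ceilDiv_mul hℓ).trans (Nat.mul_le_mul_right _ h1)

/-! ### Counting confusable pairs and bounding the average. -/

namespace Code

variable {k ℓ c δ : ℕ} {d e : Finset ℕ}

theorem Aligned.extend_eq {u v : Fin k → ZMod 2} (h : Aligned δ d e u v)
    (hd : d ∈ (Finset.range k).powersetCard δ) {p : ℕ} (hp : p ∉ disturbed k d e) :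
    extend u p = extend v p := by
  by_cases hk : p < k
  · obtain ⟨j, h1, h2⟩ := exists_nth_eq_of_notMem_disturbed hk hp
    have := h j ((nth_notMem_lt_iff hd j).1 (h1 ▸ hk))
    rwa [h1, h2] at this
  · rw [extend, extend, dif_neg hk, dif_neg hk]

/-- Aligned messages are determined by their difference and by the entries of the first message
outside `movedTo`. -/
theorem Aligned.left_eq {u v u' v' : Fin k → ZMod 2} (h : Aligned δ d e u v)
    (h' : Aligned δ d e u' v') (hsub : u - v = u' - v')
    (hu : ∀ p < k, p ∉ movedTo k δ d e → extend u p = extend u' p) : u = u' := by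
  have hsub' : ∀ p, extend u p - extend v p = extend u' p - extend v' p := fun p => by
    rw [← extend_sub, ← extend_sub, hsub]
  refine eq_of_extend_eq fun p => ?_
  induction p using Nat.strong_induction_on with
  | _ p ih =>
    intro hp
    by_cases hM : p ∈ movedTo k δ d e
    · simp only [movedTo, Finset.mem_image, Finset.mem_filter, Finset.mem_range] at hM
      obtain ⟨j, ⟨hj, hne⟩, hmax⟩ := hM
      have e1 := h j hj
      have e2 := h' j hj
      -- Alignment turns the known difference u - v at the `e`-position into the difference of u at
      -- the `e`- and `d`-positions; the earlier of the two values is known by induction.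
      have e3 := hsub' (Nat.nth (· ∉ e) j)
      rw [← e1, ← e2] at e3
      rcases lt_or_gt_of_ne hne with hlt | hlt
      · rw [max_eq_right hlt.le] at hmax
        rw [hmax] at e3 hlt
        rw [ih _ hlt (hlt.trans hp)] at e3
        exact sub_left_injective e3
      · rw [max_eq_left hlt.le] at hmax
        rw [hmax] at e3 hlt
        rw [ih _ hlt (hlt.trans hp)] at e3
        exact sub_right_injective e3
    · exact hu p hp hM

-- A pair is encoded by u outside `movedTo` and u - v on S \ Q; `hW` restores the difference on `Q`.
-- The exponent is (k - (|S| - δ)) + (|S| - |Q|).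
open Classical in
theorem card_aligned_mul_le (hd : d ∈ (Finset.range k).powersetCard δ)
    (he : e ∈ (Finset.range k).powersetCard δ) (W : Set (Fin k → ZMod 2)) (Q : Finset ℕ)
    (hQ : Q ⊆ disturbed k d e)
    (hW : ∀ w ∈ W, ∀ w' ∈ W, (∀ p < k, p ∉ Q → extend w p = extend w' p) → w = w') :
    (Finset.univ.filter fun a : (Fin k → ZMod 2) × (Fin k → ZMod 2) =>
      Aligned δ d e a.1 a.2 ∧ a.1 - a.2 ∈ W).card * 2 ^ Q.card ≤ 2 ^ (k + δ) := by
  set S := disturbed k d e with hS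
  set M := movedTo k δ d e
  have hSk : S ⊆ Finset.range k := Finset.filter_subset _ _
  let φ : (Fin k → ZMod 2) × (Fin k → ZMod 2) →
      (↥(Finset.range k \ M) → ZMod 2) × (↥(S \ Q) → ZMod 2) :=
    fun a => (fun p => extend a.1 p, fun p => extend (a.1 - a.2) p)
  have hinj : Set.InjOn φ (Finset.univ.filter fun a : (Fin k → ZMod 2) × (Fin k → ZMod 2) =>
      Aligned δ d e a.1 a.2 ∧ a.1 - a.2 ∈ W) := by
    rintro ⟨u, v⟩ ha ⟨u', v'⟩ ha' heq
    simp only [Finset.coe_filter, Finset.mem_univ, true_and, Set.mem_ofPred_eq] at ha ha'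
    have h1 := congrArg Prod.fst heq
    have h2 := congrArg Prod.snd heq
    have hsub : u - v = u' - v' := by
      refine hW _ ha.2 _ ha'.2 fun p hp hpQ => ?_
      by_cases hpS : p ∈ S
      · exact congrFun h2 ⟨p, Finset.mem_sdiff.2 ⟨hpS, hpQ⟩⟩
      · rw [extend_sub, extend_sub, ha.1.extend_eq hd hpS, ha'.1.extend_eq hd hpS, sub_self,
          sub_self]
    have hu : u = u' := ha.1.left_eq ha'.1 hsub fun p hp hpM =>
      congrFun h1 ⟨p, Finset.mem_sdiff.2 ⟨Finset.mem_range.2 hp, hpM⟩⟩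
    subst hu
    rw [sub_right_inj] at hsub
    rw [hsub]
  have hcard := Finset.card_le_card_of_injOn φ (t := Finset.univ) (fun _ _ => Finset.mem_coe.2 (Finset.mem_univ _)) hinj
  rw [Finset.card_univ, Fintype.card_prod, Fintype.card_fun, Fintype.card_fun, ZMod.card,
    Fintype.card_coe, Fintype.card_coe, ← pow_add,
    Finset.card_sdiff_of_subset (movedTo_subset hd he), Finset.card_sdiff_of_subset hQ,
    Finset.card_range] at hcard
  refine (Nat.mul_le_mul_right _ hcard).trans ?_
  rw [← pow_add]
  refine Nat.pow_le_pow_right two_pos ?_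
  have h1 : (movedTo k δ d e).card + δ = S.card := card_movedTo hd
  have h2 : Q.card ≤ S.card := Finset.card_le_card hQ
  have h3 := Finset.card_le_card hSk
  have h4 := Finset.card_le_card (movedTo_subset hd he)
  rw [Finset.card_range] at h3 h4
  omega

/-- Every element of `e` is at distance at most `B` from an element of `d`. -/
def Near (B : ℕ) (d e : Finset ℕ) : Prop := ∀ q ∈ e, ∃ p ∈ d, p ≤ q + B ∧ q ≤ p + B

-- Once `d` is chosen, `e` is a δ-subset of a union of δ windows of at most 2B + 1 positions.
open Classical in
theorem card_near_le (k δ B : ℕ) :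
    (((Finset.range k).powersetCard δ ×ˢ (Finset.range k).powersetCard δ).filter
      fun a => Near B a.1 a.2).card ≤ k ^ δ * (δ * (2 * B + 1)) ^ δ := by
  have hsub : (((Finset.range k).powersetCard δ ×ˢ (Finset.range k).powersetCard δ).filter
      fun a => Near B a.1 a.2) ⊆ ((Finset.range k).powersetCard δ).biUnion fun d =>
        ((d.biUnion fun p => Finset.Icc (p - B) (p + B)).powersetCard δ).image fun e => (d, e) := by
    rintro ⟨d, e⟩ h
    simp only [Finset.mem_filter, Finset.mem_product] at h
    obtain ⟨⟨hd, he⟩, h⟩ := h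
    rw [Finset.mem_biUnion]
    refine ⟨d, hd, Finset.mem_image_of_mem _ ?_⟩
    rw [Finset.mem_powersetCard] at he ⊢
    refine ⟨fun q hq => ?_, he.2⟩
    obtain ⟨p, hp, h1, h2⟩ := h q hq
    rw [Finset.mem_biUnion]
    exact ⟨p, hp, Finset.mem_Icc.2 ⟨by omega, by omega⟩⟩
  refine (Finset.card_le_card hsub).trans ?_
  refine (Finset.card_biUnion_le_card_mul _ _ ((δ * (2 * B + 1)) ^ δ) fun d hd => ?_).trans ?_
  · refine Finset.card_image_le.trans ?_
    rw [Finset.card_powersetCard]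
    refine (Nat.choose_le_pow _ _).trans (Nat.pow_le_pow_left ?_ _)
    rw [← (Finset.mem_powersetCard.1 hd).2]
    refine Finset.card_biUnion_le_card_mul _ _ _ fun p _ => ?_
    rw [Nat.card_Icc]
    omega
  · refine Nat.mul_le_mul_right _ ?_
    rw [Finset.card_powersetCard, Finset.card_range]
    exact Nat.choose_le_pow _ _

variable (C : Code k ℓ c)

open Classical in
theorem card_confused_le (hℓ : 0 < ℓ) (hc : 3 * δ ≤ c)
    (hd : d ∈ (Finset.range k).powersetCard δ) (he : e ∈ (Finset.range k).powersetCard δ) :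
    let N := (Finset.univ.filter fun a : (Fin k → ZMod 2) × (Fin k → ZMod 2) =>
      a.2 ≠ a.1 ∧ C.parities a.2 = C.parities a.1 ∧ Aligned δ d e a.1 a.2).card
    N * 2 ^ (c * ℓ) ≤ 2 ^ (k + δ) ∨
      Near ((c + 2 * δ) * ℓ) d e ∧ N * 2 ^ ((δ + 1) * ℓ) ≤ 2 ^ (k + δ) := by
  intro N
  -- One confused pair is needed to know that S touches more than c blocks.
  rcases Nat.eq_zero_or_pos N with hN | hN
  · left
    rw [hN]
    simp
  obtain ⟨⟨u, v⟩, huv⟩ := Finset.card_pos.1 hN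
  simp only [Finset.mem_filter, Finset.mem_univ, true_and] at huv
  obtain ⟨hne, hpar, hal⟩ := huv
  set S := disturbed k d e with hS
  set K := k ⌈/⌉ ℓ
  have hT : c < (touched K ℓ S).card :=
    C.lt_card_touched hℓ (sub_ne_zero.2 (Ne.symm hne)) (by rw [parities_sub, hpar, sub_self])
      fun p hp => by rw [extend_sub, hal.extend_eq hd hp, sub_self]
  have hF : (touched K ℓ S).card ≤ (filled K ℓ S).card + 2 * δ := card_touched_le hd he K ℓ
  have hbound : ∀ A ⊆ filled K ℓ S, A.card ≤ c → N * 2 ^ (A.card * ℓ) ≤ 2 ^ (k + δ) := by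
    intro A hA hAc
    have h1 := card_aligned_mul_le hd he {w | C.parities w = 0} (blockPositions ℓ A)
      (blockPositions_subset hA)
      fun w hw w' hw' h => C.eq_of_parities_eq hℓ hAc (Eq.trans hw (Eq.symm hw')) h
    rw [card_blockPositions] at h1
    refine le_trans (Nat.mul_le_mul_right _ (Finset.card_le_card ?_)) h1
    intro a ha
    simp only [Finset.mem_filter, Finset.mem_univ, true_and] at ha ⊢
    refine ⟨ha.2.2, ?_⟩
    show C.parities (a.1 - a.2) = 0
    rw [parities_sub, ha.2.1, sub_self]
  rcases le_or_gt c (filled K ℓ S).card with h | h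
  · left
    obtain ⟨A, hA, hAc⟩ := Finset.exists_subset_card_eq h
    simpa [hAc] using hbound A hA hAc.le
  · right
    refine ⟨fun q hq => exists_near_of_card_disturbed_lt hd he ?_ hq,
      le_trans (Nat.mul_le_mul_left _ (Nat.pow_le_pow_right two_pos (Nat.mul_le_mul_right _ ?_)))
        (hbound _ subset_rfl h.le)⟩
    · refine (card_le_card_touched_mul (K := K) hℓ S ?_).trans_lt (Nat.mul_lt_mul_of_pos_right (by omega) hℓ)
      exact (Finset.filter_subset _ _).trans (Finset.range_subset_range.2 (le_ceilDiv_mul hℓ))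
    · omega

open Classical in
theorem sum_card_confusable_le (hℓ : 0 < ℓ) (hc : 3 * δ ≤ c) :
    ((∑ u : Fin k → ZMod 2, (Finset.univ.filter fun v => C.Confusable δ u v).card : ℕ) : ℝ) ≤
      (2 : ℝ) ^ (k + δ) * ((k : ℝ) ^ δ * (k : ℝ) ^ δ / 2 ^ (c * ℓ) +
        (k : ℝ) ^ δ * ((δ : ℝ) * (2 * ((c + 2 * δ) * ℓ) + 1)) ^ δ / 2 ^ ((δ + 1) * ℓ)) := by
  set X := (Finset.range k).powersetCard δ
  set N : Finset ℕ × Finset ℕ → ℕ := fun b =>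
    (Finset.univ.filter fun a : (Fin k → ZMod 2) × (Fin k → ZMod 2) =>
      a.2 ≠ a.1 ∧ C.parities a.2 = C.parities a.1 ∧ Aligned δ b.1 b.2 a.1 a.2).card with hN
  have h1 : ∑ u : Fin k → ZMod 2, (Finset.univ.filter fun v => C.Confusable δ u v).card ≤
      ∑ b ∈ X ×ˢ X, N b := by
    rw [← Finset.card_sigma]
    refine le_trans ?_ Finset.card_biUnion_le
    refine Finset.card_le_card_of_injOn (fun a => (a.1, a.2)) ?_ ?_
    · rintro ⟨u, v⟩ h
      simp only [Finset.coe_sigma, Finset.coe_univ, Finset.coe_filter, Set.mem_sigma_iff,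
        Finset.mem_univ, true_and, Set.mem_ofPred_eq, Set.mem_univ] at h
      obtain ⟨h2, h3, d, hd, e, he, h4⟩ := h
      simp only [Finset.coe_biUnion, Set.mem_iUnion, Finset.coe_filter, Finset.mem_univ, true_and,
        Set.mem_ofPred_eq]
      exact ⟨(d, e), Finset.mem_coe.2 (Finset.mem_product.2 ⟨hd, he⟩), h2, h3, h4⟩
    · rintro ⟨u, v⟩ - ⟨u', v'⟩ - h
      simp only [Prod.mk.injEq] at h
      obtain ⟨rfl, rfl⟩ := h
      rfl
  have h2 : ∀ b ∈ X ×ˢ X, (N b : ℝ) ≤ (2 : ℝ) ^ (k + δ) / 2 ^ (c * ℓ) +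
      if Near ((c + 2 * δ) * ℓ) b.1 b.2 then (2 : ℝ) ^ (k + δ) / 2 ^ ((δ + 1) * ℓ) else 0 := by
    rintro ⟨d, e⟩ hb
    rw [Finset.mem_product] at hb
    rcases C.card_confused_le hℓ hc hb.1 hb.2 with h | ⟨h3, h⟩
    · have h5 : (N (d, e) : ℝ) ≤ (2 : ℝ) ^ (k + δ) / 2 ^ (c * ℓ) := by
        rw [le_div_iff₀ (by positivity)]
        exact_mod_cast h
      refine h5.trans (le_add_of_nonneg_right ?_)
      split
      · positivity
      · exact le_rfl
    · have h5 : (N (d, e) : ℝ) ≤ (2 : ℝ) ^ (k + δ) / 2 ^ ((δ + 1) * ℓ) := by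
        rw [le_div_iff₀ (by positivity)]
        exact_mod_cast h
      rw [if_pos h3]
      refine h5.trans (le_add_of_nonneg_left ?_)
      positivity
  have hX : (X.card : ℝ) ≤ (k : ℝ) ^ δ := by
    have h := Nat.choose_le_pow k δ
    rw [Finset.card_powersetCard, Finset.card_range]
    exact_mod_cast h
  have hnear : ((((X ×ˢ X).filter fun a => Near ((c + 2 * δ) * ℓ) a.1 a.2).card : ℕ) : ℝ) ≤
      (k : ℝ) ^ δ * ((δ : ℝ) * (2 * ((c + 2 * δ) * ℓ) + 1)) ^ δ := by
    have h := card_near_le k δ ((c + 2 * δ) * ℓ)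
    exact_mod_cast h
  calc ((∑ u : Fin k → ZMod 2, (Finset.univ.filter fun v => C.Confusable δ u v).card : ℕ) : ℝ)
      ≤ ((∑ b ∈ X ×ˢ X, N b : ℕ) : ℝ) := by exact_mod_cast h1
    _ = ∑ b ∈ X ×ˢ X, (N b : ℝ) := by push_cast; rfl
    _ ≤ _ := Finset.sum_le_sum h2
    _ = (X.card * X.card) * ((2 : ℝ) ^ (k + δ) / 2 ^ (c * ℓ)) +
        (((X ×ˢ X).filter fun a => Near ((c + 2 * δ) * ℓ) a.1 a.2).card : ℕ) *
          ((2 : ℝ) ^ (k + δ) / 2 ^ ((δ + 1) * ℓ)) := by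
        rw [Finset.sum_add_distrib, Finset.sum_const, ← Finset.sum_filter, Finset.sum_const,
          Finset.card_product, nsmul_eq_mul, nsmul_eq_mul]
        push_cast
        rfl
    _ ≤ ((k : ℝ) ^ δ * (k : ℝ) ^ δ) * ((2 : ℝ) ^ (k + δ) / 2 ^ (c * ℓ)) +
        ((k : ℝ) ^ δ * ((δ : ℝ) * (2 * ((c + 2 * δ) * ℓ) + 1)) ^ δ) *
          ((2 : ℝ) ^ (k + δ) / 2 ^ ((δ + 1) * ℓ)) := by gcongr
    _ = _ := by ring

theorem one_le_averageListSize (hk : 0 < k) (hℓ : 0 < ℓ) (hδℓ : δ ≤ ℓ) (hδk : δ ≤ k) :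
    1 ≤ C.averageListSize δ := by
  rw [averageListSize, le_div_iff₀ (by positivity), one_mul]
  calc (2 : ℝ) ^ k = ∑ _u : Fin k → ZMod 2, (1 : ℝ) := by simp
    _ ≤ _ := Finset.sum_le_sum fun u _ => by
      exact_mod_cast C.one_le_listSize hk hℓ hδℓ hδk u

theorem averageListSize_le (hℓ : 0 < ℓ) (hδc : δ < c) (hc : 3 * δ ≤ c) (hδk : δ ≤ k) :
    C.averageListSize δ ≤
      1 + 2 ^ δ * (1 + ((δ : ℝ) * (2 * (c + 2 * δ) + 1)) ^ δ) * ((ℓ : ℝ) ^ (2 * δ) / 2 ^ ℓ) := by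
  classical
  have h1 : ∑ u : Fin k → ZMod 2, (C.listSize δ u : ℝ) ≤ 2 ^ k +
      ((∑ u : Fin k → ZMod 2, (Finset.univ.filter fun v => C.Confusable δ u v).card : ℕ) : ℝ) := by
    have h : ∑ u : Fin k → ZMod 2, C.listSize δ u ≤ ∑ u : Fin k → ZMod 2,
        (1 + (Finset.univ.filter fun v => C.Confusable δ u v).card) :=
      Finset.sum_le_sum fun u _ => C.listSize_le hδk u
    rw [Finset.sum_add_distrib, Finset.sum_const, Finset.card_univ, Fintype.card_fun, ZMod.card,
      Fintype.card_fin, smul_eq_mul, mul_one] at h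
    exact_mod_cast h
  -- For δ = 0 possibly c = 1, where the MDS length bound is not available, but the power is then
  -- trivial.
  have hk : (k : ℝ) ^ δ ≤ (ℓ : ℝ) ^ δ * 2 ^ (δ * ℓ) := by
    rcases Nat.eq_zero_or_pos δ with rfl | hδ
    · simp
    · have h : k ^ δ ≤ (ℓ * 2 ^ ℓ) ^ δ := Nat.pow_le_pow_left (C.le_mul_two_pow hℓ (by omega)) _
      rw [mul_pow, ← pow_mul, mul_comm ℓ δ] at h
      exact_mod_cast h
  have hℓ1 : (1 : ℝ) ≤ ℓ := by exact_mod_cast hℓ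
  have h2 : (k : ℝ) ^ δ * (k : ℝ) ^ δ / 2 ^ (c * ℓ) ≤ (ℓ : ℝ) ^ (2 * δ) / 2 ^ ℓ := by
    rw [div_le_div_iff₀ (by positivity) (by positivity)]
    calc (k : ℝ) ^ δ * (k : ℝ) ^ δ * 2 ^ ℓ
        ≤ ((ℓ : ℝ) ^ δ * 2 ^ (δ * ℓ)) * ((ℓ : ℝ) ^ δ * 2 ^ (δ * ℓ)) * 2 ^ ℓ := by gcongr
      _ = (ℓ : ℝ) ^ (2 * δ) * 2 ^ ((2 * δ + 1) * ℓ) := by ring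
      -- Here 2δ + 1 ≤ c: from 3δ ≤ c if δ ≥ 1, and from δ < c if δ = 0.
      _ ≤ (ℓ : ℝ) ^ (2 * δ) * 2 ^ (c * ℓ) := by
        gcongr
        · norm_num
        · omega
  have h3 : (k : ℝ) ^ δ * ((δ : ℝ) * (2 * ((c + 2 * δ) * ℓ) + 1)) ^ δ / 2 ^ ((δ + 1) * ℓ) ≤
      ((δ : ℝ) * (2 * (c + 2 * δ) + 1)) ^ δ * ((ℓ : ℝ) ^ (2 * δ) / 2 ^ ℓ) := by
    rw [← mul_div_assoc, div_le_div_iff₀ (by positivity) (by positivity)]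
    have h4 : (δ : ℝ) * (2 * ((c + 2 * δ) * ℓ) + 1) ≤ (δ : ℝ) * (2 * (c + 2 * δ) + 1) * ℓ := by
      rw [mul_assoc]
      refine mul_le_mul_of_nonneg_left ?_ (by positivity)
      linarith
    calc (k : ℝ) ^ δ * ((δ : ℝ) * (2 * ((c + 2 * δ) * ℓ) + 1)) ^ δ * 2 ^ ℓ
        ≤ ((ℓ : ℝ) ^ δ * 2 ^ (δ * ℓ)) * ((δ : ℝ) * (2 * (c + 2 * δ) + 1) * ℓ) ^ δ * 2 ^ ℓ := by
          gcongr
      _ = _ := by rw [mul_pow _ (ℓ : ℝ)]; ring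
  rw [averageListSize, div_le_iff₀ (by positivity)]
  refine h1.trans ?_
  have h5 := C.sum_card_confusable_le hℓ hc
  calc _ ≤ (2 : ℝ) ^ k + 2 ^ (k + δ) * ((ℓ : ℝ) ^ (2 * δ) / 2 ^ ℓ +
        ((δ : ℝ) * (2 * (c + 2 * δ) + 1)) ^ δ * ((ℓ : ℝ) ^ (2 * δ) / 2 ^ ℓ)) := by
        refine add_le_add le_rfl (h5.trans ?_)
        gcongr
    _ = _ := by rw [pow_add]; ring

end Code

end GC

/-- For any sequence of GC codes for `δ` deletions with `c > δ`, `c ≥ 3 δ` parity symbols, whose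
message lengths `k i` tend to infinity and whose chunking lengths satisfy `ℓ i = Ω(log (k i))`,
the average list size tends to `1`. -/
theorem corollary1 (δ c : ℕ) (hδc : δ < c) (hc : 3 * δ ≤ c)
    (k ℓ : ℕ → ℕ) (hk : Tendsto k atTop atTop)
    (hℓ : (fun i => Real.log (k i)) =O[atTop] fun i => (ℓ i : ℝ))
    (C : ∀ i, GC.Code (k i) (ℓ i) c) :
    Tendsto (fun i => (C i).averageListSize δ) atTop (𝓝 1) := by
  have hlog : Tendsto (fun i => Real.log (k i)) atTop atTop :=
    Real.tendsto_log_atTop.comp (tendsto_natCast_atTop_atTop.comp hk)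
  -- The growth condition enters only through ℓ → ∞; the quantitative relation of k to ℓ comes from
  -- the MDS property.
  have hℓ' : Tendsto ℓ atTop atTop := by
    obtain ⟨A, hA, hbound⟩ := hℓ.exists_pos
    have h1 : Tendsto (fun i => A * (ℓ i : ℝ)) atTop atTop := by
      refine tendsto_atTop_mono' _ ?_ hlog
      filter_upwards [hbound.bound] with i hi
      rw [Real.norm_natCast] at hi
      exact (Real.le_norm_self _).trans hi
    exact tendsto_natCast_atTop_iff.1 ((tendsto_const_mul_atTop_of_pos hA).1 h1)
  have hlim : Tendsto (fun i => 1 + 2 ^ δ * (1 + ((δ : ℝ) * (2 * (c + 2 * δ) + 1)) ^ δ) *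
      ((ℓ i : ℝ) ^ (2 * δ) / 2 ^ ℓ i)) atTop (𝓝 1) := by
    have h1 := (tendsto_pow_const_div_const_pow_of_one_lt (2 * δ) (one_lt_two (α := ℝ))).comp hℓ'
    simpa using (h1.const_mul (2 ^ δ * (1 + ((δ : ℝ) * (2 * (c + 2 * δ) + 1)) ^ δ))).const_add 1
  refine tendsto_of_tendsto_of_tendsto_of_le_of_le' tendsto_const_nhds hlim ?_ ?_
  · filter_upwards [hk.eventually_ge_atTop (δ + 1), hℓ'.eventually_ge_atTop (δ + 1)] with i h1 h2
    exact (C i).one_le_averageListSize (by omega) (by omega) (by omega) (by omega)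
  · filter_upwards [hk.eventually_ge_atTop δ, hℓ'.eventually_ge_atTop 1] with i h1 h2
    exact (C i).averageListSize_le h2 hδc hc h1
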